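/- Let $\mathbb{D}=\{w\in\mathbb{C}:|w|<1\}$. For a sequence $\alpha=(\alpha_n)_{n\in\mathbb{Z}}$ in $\mathbb{D}$ put $\rho_n=(1-|\alpha_n|^2)^{1/2}$, and let $\mathcal{E}_\alpha$ be the extended CMV matrix with Verblunsky coefficients $\alpha$, that is, the bounded operator on $\ell^2(\mathbb{Z})$ given, for all $k\in\mathbb{Z}$ and $\psi\in\ell^2(\mathbb{Z})$, by $$(\mathcal{E}_\alpha\psi)_{2k}=\bar\alpha_{2k}\rho_{2k-1}\psi_{2k-1}-\bar\alpha_{2k}\alpha_{2k-1}\psi_{2k}+\bar\alpha_{2k+1}\rho_{2k}\psi_{2k+1}+\rho_{2k+1}\rho_{2k}\psi_{2k+2},$$ $$(\mathcal{E}_\alpha\psi)_{2k+1}=\rho_{2k}\rho_{2k-1}\psi_{2k-1}-\rho_{2k}\alpha_{2k-1}\psi_{2k}-\bar\alpha_{2k+1}\alpha_{2k}\psi_{2k+1}-\rho_{2k+1}\alpha_{2k}\psi_{2k+2}.$$ Let $\nu$ be a Borel probability measure on $\mathbb{D}$ whose topological support $\mathrm{supp}\,\nu$ is contained in $[0,1]$.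 Then $a=\min\mathrm{supp}\,\nu$ exists, and the almost sure spectrum of the extended CMV matrices with independent, $\nu$-distributed Verblunsky coefficients is $$\Sigma=\{e^{i\theta}:\theta\in[-\pi,\pi),\ |\theta|\ge 2\arcsin a\}=\partial\mathbb{D}\setminus R_a,\qquad R_a=\{e^{i\theta}:-2\arcsin a<\theta<2\arcsin a\}$$ (with $R_0=\emptyset$). That is, $\Sigma$ is a closed subset of $\partial\mathbb{D}$, and $\sigma(\mathcal{E}_\omega)=\Sigma$ for almost every $\omega\in\mathbb{D}^{\mathbb{Z}}$ with respect to the product measure $\nu^{\mathbb{Z}}$. -/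

import Mathlib

open MeasureTheory

/-- The open unit disk of the complex plane (a subtype of `ℂ`, with the subspace topology and its
Borel σ-algebra). -/
abbrev Disk : Type := Metric.ball (0 : ℂ) 1

/-- The Hilbert space `ℓ²(ℤ)` of square-summable complex sequences. -/
abbrev EllTwo : Type := lp (fun _ : ℤ => ℂ) 2

/-- `ρ(α) = (1 - |α|²)^{1/2}`, regarded as a complex number. -/
noncomputable def rho (α : Disk) : ℂ := (Real.sqrt (1 - ‖(α : ℂ)‖ ^ 2) : ℝ)

/-- The entry in row `n` and column `m` of the (five-diagonal) extended CMV matrix with Verblunsky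
coefficients `(α n)`, `n ∈ ℤ`. The nonzero entries in the even row `n = 2k` are
`conj α_{2k} ρ_{2k-1}`, `- conj α_{2k} α_{2k-1}`, `conj α_{2k+1} ρ_{2k}`, `ρ_{2k+1} ρ_{2k}`
in the columns `2k-1`, `2k`, `2k+1`, `2k+2`; those in the odd row `n = 2k+1` are
`ρ_{2k} ρ_{2k-1}`, `- ρ_{2k} α_{2k-1}`, `- conj α_{2k+1} α_{2k}`, `- ρ_{2k+1} α_{2k}`
in the columns `2k-1`, `2k`, `2k+1`, `2k+2`. -/
noncomputable def cmvMatrix (α : ℤ → Disk) : Matrix ℤ ℤ ℂ := fun n m =>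
  if Even n then
    if m = n - 1 then star (α n : ℂ) * rho (α (n - 1))
    else if m = n then - (star (α n : ℂ) * (α (n - 1) : ℂ))
    else if m = n + 1 then star (α (n + 1) : ℂ) * rho (α n)
    else if m = n + 2 then rho (α (n + 1)) * rho (α n)
    else 0
  else
    if m = n - 2 then rho (α (n - 1)) * rho (α (n - 2))
    else if m = n - 1 then - (rho (α (n - 1)) * (α (n - 2) : ℂ))
    else if m = n then - (star (α n : ℂ) * (α (n - 1) : ℂ))
    else if m = n + 1 then - (rho (α n) * (α (n - 1) : ℂ))
    else 0

/-- The matrix-vector product `(𝓔 ψ)(n) = ∑_m 𝓔_{n,m} ψ(m)`; as `𝓔_{n,m} = 0` for `|n - m| > 2`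
(see `cmvMatrix_eq_zero`), the sum is written over `m = n + d` with `-2 ≤ d ≤ 2`. -/
noncomputable def cmvApply (α : ℤ → Disk) (ψ : ℤ → ℂ) : ℤ → ℂ := fun n =>
  ∑ d ∈ Finset.Icc (-2 : ℤ) 2, cmvMatrix α n (n + d) * ψ (n + d)

theorem cmvMatrix_eq_zero (α : ℤ → Disk) (n m : ℤ) (h : 2 < |m - n|) :
    cmvMatrix α n m = 0 := by
  have h' : m ≠ n - 2 ∧ m ≠ n - 1 ∧ m ≠ n ∧ m ≠ n + 1 ∧ m ≠ n + 2 := by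
    refine ⟨?_, ?_, ?_, ?_, ?_⟩ <;> rintro rfl <;> simp at h
  simp [cmvMatrix, h']

theorem norm_disk_le (α : Disk) : ‖(α : ℂ)‖ ≤ 1 :=
  le_of_lt (mem_ball_zero_iff.1 α.2)

theorem norm_rho_le (α : Disk) : ‖rho α‖ ≤ 1 := by
  rw [rho, Complex.norm_real, Real.norm_of_nonneg (Real.sqrt_nonneg _)]
  exact Real.sqrt_le_one.2 (by nlinarith [norm_nonneg (α : ℂ)])

theorem norm_cmvMatrix_le (α : ℤ → Disk) (n m : ℤ) : ‖cmvMatrix α n m‖ ≤ 1 := by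
  have h1 := fun k => norm_disk_le (α k)
  have h2 := fun k => norm_rho_le (α k)
  unfold cmvMatrix
  split_ifs <;> simp only [norm_neg, norm_mul, norm_star, norm_zero] <;>
    first
      | exact zero_le_one
      | exact mul_le_one₀ (by first | exact h1 _ | exact h2 _) (norm_nonneg _)
          (by first | exact h1 _ | exact h2 _)

theorem memℓp_shift (ψ : EllTwo) (d : ℤ) :
    Memℓp (fun n : ℤ => (ψ (n + d) : ℂ)) 2 := by
  have h := lp.memℓp ψ
  rw [memℓp_gen_iff (by norm_num)] at h ⊢
  exact (Equiv.addRight d).summable_iff.2 h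

theorem norm_shift (ψ : EllTwo) (d : ℤ) :
    ‖(⟨fun n : ℤ => (ψ (n + d) : ℂ), memℓp_shift ψ d⟩ : EllTwo)‖ = ‖ψ‖ := by
  rw [lp.norm_eq_tsum_rpow (by norm_num), lp.norm_eq_tsum_rpow (by norm_num)]
  congr 1
  exact (Equiv.addRight d).tsum_eq (fun n => ‖(ψ n : ℂ)‖ ^ (2 : ENNReal).toReal)

theorem memℓp_cmvTerm (α : ℤ → Disk) (d : ℤ) (ψ : EllTwo) :
    Memℓp (fun n : ℤ => cmvMatrix α n (n + d) * (ψ (n + d) : ℂ)) 2 := by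
  have h := memℓp_shift ψ d
  rw [memℓp_gen_iff (by norm_num)] at h ⊢
  refine h.of_nonneg_of_le (fun n => by positivity) (fun n => ?_)
  refine Real.rpow_le_rpow (norm_nonneg _) ?_ (by norm_num)
  rw [norm_mul]
  exact mul_le_of_le_one_left (norm_nonneg _) (norm_cmvMatrix_le α _ _)

/-- One of the five diagonals of the extended CMV matrix, as a bounded operator on `ℓ²(ℤ)`. -/
noncomputable def cmvDiagonal (α : ℤ → Disk) (d : ℤ) : EllTwo →L[ℂ] EllTwo :=
  LinearMap.mkContinuous
    { toFun := fun ψ => ⟨fun n : ℤ => cmvMatrix α n (n + d) * (ψ (n + d) : ℂ),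
        memℓp_cmvTerm α d ψ⟩
      map_add' := fun ψ φ => by
        ext n
        exact mul_add _ _ _
      map_smul' := fun c ψ => by
        ext n
        exact mul_left_comm _ _ _ }
    1 (fun ψ => by
      rw [one_mul, ← norm_shift ψ d]
      refine lp.norm_mono (by norm_num) (fun n => ?_)
      change ‖cmvMatrix α n (n + d) * (ψ (n + d) : ℂ)‖ ≤ ‖(ψ (n + d) : ℂ)‖
      rw [norm_mul]
      exact mul_le_of_le_one_left (norm_nonneg _) (norm_cmvMatrix_le α _ _))

/-- The extended CMV matrix with Verblunsky coefficients `α`, as a bounded operator on `ℓ²(ℤ)`: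
the sum of its five diagonals. By `extendedCMV_apply` it acts as the matrix `cmvMatrix α`. -/
noncomputable def extendedCMV (α : ℤ → Disk) : EllTwo →L[ℂ] EllTwo :=
  ∑ d ∈ Finset.Icc (-2 : ℤ) 2, cmvDiagonal α d

theorem extendedCMV_apply (α : ℤ → Disk) (ψ : EllTwo) (n : ℤ) :
    (extendedCMV α ψ : EllTwo) n = cmvApply α (fun m => ψ m) n := by
  simp only [extendedCMV, cmvApply, _root_.sum_apply, lp.coeFn_sum,
    Finset.sum_apply]
  rfl

/-- `Sig` is the almost sure spectrum of the extended CMV matrices whose Verblunsky coefficients are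
independent with common distribution `ν`: it is a closed subset of the unit circle, and for almost
every `ω` with respect to the product measure `ν^ℤ`, the spectrum of the extended CMV matrix with
coefficients `(ω n)` equals `Sig`. -/
def IsAlmostSureSpectrum (ν : Measure Disk) [IsProbabilityMeasure ν] (Sig : Set ℂ) : Prop :=
  IsClosed Sig ∧ Sig ⊆ Metric.sphere (0 : ℂ) 1 ∧
    ∀ᵐ ω ∂(Measure.infinitePi (fun _ : ℤ => ν)), spectrum ℂ (extendedCMV ω) = Sig

/-- The open arc `R_a = {e^{iθ} : -2 arcsin a < θ < 2 arcsin a}` (empty for `a = 0`). -/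
def gapArc (a : ℝ) : Set ℂ :=
  {z | ∃ θ : ℝ, -(2 * Real.arcsin a) < θ ∧ θ < 2 * Real.arcsin a ∧
    z = Complex.exp (θ * Complex.I)}

/-- The real points of the topological support of `ν`. -/
def realSupport (ν : Measure Disk) : Set ℝ :=
  {t : ℝ | ∃ α ∈ ν.support, (α : ℂ) = (t : ℂ)}

/-! For real coefficients the CMV matrix is a product `L * M` of two direct sums of 2×2 reflections,
both involutions, and `(L + M)² = 2 + L * M + M * L`. The spectrum on the circle is thus controlled
by the tridiagonal operator `J = L + M`, with off-diagonal entries `ρ_n` and diagonal `t_n -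
t_{n-1}`.

No spectrum in the gap: `J` sees only differences of the `t_n`, so `t` may be replaced by `t - a` in
both summands. Each block then has squared norm `(t - a)² + 1 - t² ≤ 1 - a²`, because `t ≥ a ≥ 0`.
So `‖J‖² ≤ 4(1 - a²)`, which becomes `Re z ≤ 1 - 2a²` (`two_add_two_mul_re_le_of_mem_spectrum`).

Everything else is spectrum: almost surely there are arbitrarily long stretches with coefficients
close to `a` (`ae_exists_stretch`). There `J` resembles the free operator with off-diagonal `r = √(1
- a²)`, and truncated plane waves are approximate eigenvectors for each point of `[-2r, 2r]`. If `z
= μ² ≠ 1` were a regular value of `L * M`, then `J - (μ + μ⁻¹)` would have a bounded left inverse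
(`exists_left_inverse_add_sub`), a contradiction. -/

/-! ### Spectra of products of two involutions -/

section Algebra

variable {A : Type*} [NormedRing A] [NormedAlgebra ℂ A]

/-- Both `L * M` and its inverse `M * L` are contractions, so `z` and `z⁻¹` lie in the closed disk.
-/
theorem norm_eq_one_of_mem_spectrum_mul_involutions [CompleteSpace A] [NormOneClass A] {L M : A}
    (hL : L * L = 1) (hM : M * M = 1) (hLn : ‖L‖ ≤ 1) (hMn : ‖M‖ ≤ 1)
    {z : ℂ} (hz : z ∈ spectrum ℂ (L * M)) : ‖z‖ = 1 := by
  have hLM : ‖L * M‖ ≤ 1 := (norm_mul_le _ _).trans (mul_le_one₀ hLn (norm_nonneg _) hMn)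
  have hML : ‖M * L‖ ≤ 1 := (norm_mul_le _ _).trans (mul_le_one₀ hMn (norm_nonneg _) hLn)
  let u : Aˣ := ⟨L * M, M * L, by rw [mul_assoc, ← mul_assoc M, hM, one_mul, hL],
    by rw [mul_assoc, ← mul_assoc L, hL, one_mul, hM]⟩
  have h1 : ‖z‖ ≤ 1 := (spectrum.norm_le_norm_of_mem hz).trans hLM
  have hz' : z⁻¹ ∈ spectrum ℂ (M * L) := by
    have : z⁻¹⁻¹ ∈ spectrum ℂ (u : A) := by rwa [inv_inv]
    exact spectrum.inv₀_mem_iff.1 this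
  have h2 : ‖z⁻¹‖ ≤ 1 := (spectrum.norm_le_norm_of_mem hz').trans hML
  have hz0 : z ≠ 0 := by
    rintro rfl
    exact spectrum.zero_notMem ℂ u.isUnit hz
  rw [norm_inv] at h2
  exact le_antisymm h1 ((inv_le_one₀ (norm_pos_iff.2 hz0)).1 h2)

/-- A lower bound for `‖L + M‖` in terms of the spectrum of the product `L * M` of two
involutions. -/
theorem two_add_two_mul_re_le_of_mem_spectrum [CompleteSpace A] [NormOneClass A] {L M : A}
    (hL : L * L = 1) (hM : M * M = 1) {z : ℂ} (hz1 : ‖z‖ = 1)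
    (hz : z ∈ spectrum ℂ (L * M)) : 2 + 2 * z.re ≤ ‖L + M‖ ^ 2 := by
  have hz0 : z ≠ 0 := by
    rintro rfl
    simp at hz1
  have hzs : z + z⁻¹ = ((2 * z.re : ℝ) : ℂ) := by
    rw [Complex.inv_eq_conj hz1, Complex.add_conj]
  -- The difference factors as `(z - L * M) * (1 - z⁻¹ • (M * L))` with commuting factors, so if it
  -- were a unit, `z - L * M` would be one too.
  have key : (2 + z + z⁻¹ : ℂ) ∈ spectrum ℂ ((L + M) * (L + M)) := by
    rw [spectrum.mem_iff] at hz ⊢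
    intro hu
    apply hz
    have h1 : algebraMap ℂ A (2 + z + z⁻¹) - (L + M) * (L + M)
        = (algebraMap ℂ A z - L * M) * (1 - z⁻¹ • (M * L)) := by
      have e : L * M * (M * L) = 1 := by rw [mul_assoc, ← mul_assoc M, hM, one_mul, hL]
      simp only [Algebra.algebraMap_eq_smul_one, add_mul, mul_add, mul_sub, sub_mul, hL, hM,
        add_smul, mul_smul_comm, smul_mul_assoc, mul_one, one_mul, e, smul_sub]
      match_scalars <;> field_simp
      ring
    have h2 : algebraMap ℂ A (2 + z + z⁻¹) - (L + M) * (L + M)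
        = (1 - z⁻¹ • (M * L)) * (algebraMap ℂ A z - L * M) := by
      have e : M * L * (L * M) = 1 := by rw [mul_assoc, ← mul_assoc L, hL, one_mul, hM]
      simp only [Algebra.algebraMap_eq_smul_one, add_mul, mul_add, mul_sub, sub_mul, hL, hM,
        add_smul, mul_smul_comm, smul_mul_assoc, mul_one, one_mul, e, smul_sub]
      match_scalars <;> field_simp
      ring
    have hc : Commute (algebraMap ℂ A z - L * M) (1 - z⁻¹ • (M * L)) := h1.symm.trans h2
    rw [h1] at hu
    exact (hc.isUnit_mul_iff.1 hu).1
  have h := (spectrum.norm_le_norm_of_mem key).trans (norm_mul_le _ _)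
  rw [add_assoc, hzs, ← sq] at h
  have h3 : (2 + ((2 * z.re : ℝ) : ℂ)) = ((2 + 2 * z.re : ℝ) : ℂ) := by push_cast; ring
  rw [h3, Complex.norm_real] at h
  exact (le_abs_self _).trans h

/-- If `μ²` is not in the spectrum of the product `L * M` of two involutions, then `μ + μ⁻¹` is a
regular value of `L + M`. -/
theorem exists_left_inverse_add_sub {L M : A} (hL : L * L = 1) (hM : M * M = 1) {μ : ℂ}
    (hμ0 : μ ≠ 0) (hμ : μ ^ 2 ≠ 1) (h : μ ^ 2 ∉ spectrum ℂ (L * M)) :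
    ∃ X : A, X * (L + M - algebraMap ℂ A (μ + μ⁻¹)) = 1 := by
  have hU : IsUnit (algebraMap ℂ A (μ ^ 2) - L * M) := spectrum.notMem_iff.1 h
  obtain ⟨Y, hY⟩ := hU.exists_left_inv
  -- This inverts `1 - μ • L`, and is where `μ² ≠ 1` enters.
  have hV : (1 + μ • L) * (1 - μ • L) = (1 - μ ^ 2) • (1 : A) := by
    simp only [add_mul, mul_sub, mul_one, one_mul, smul_mul_assoc, mul_smul_comm, hL, smul_add]
    match_scalars <;> ring
  have hid : (algebraMap ℂ A (μ ^ 2) - L * M) * (1 - μ • L)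
      = (μ ^ 2 • L + μ • (L * M)) * (L + M - algebraMap ℂ A (μ + μ⁻¹)) := by
    have e : L * M * M = L := by rw [mul_assoc, hM, mul_one]
    simp only [Algebra.algebraMap_eq_smul_one, add_mul, mul_add, mul_sub, sub_mul, hL, e,
      add_smul, mul_smul_comm, smul_mul_assoc, mul_one, one_mul, smul_add, smul_sub]
    match_scalars <;> field_simp <;> ring
  have hne : (1 - μ ^ 2) ≠ 0 := sub_ne_zero.2 hμ.symm
  refine ⟨((1 - μ ^ 2)⁻¹ • (1 + μ • L)) * Y * (μ ^ 2 • L + μ • (L * M)), ?_⟩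
  rw [mul_assoc, ← hid, mul_assoc, ← mul_assoc Y, hY, one_mul, smul_mul_assoc, hV, smul_smul,
    inv_mul_cancel₀ hne, one_smul]

end Algebra

/-! ### Direct sums of 2×2 blocks and the factorization -/

theorem hasSum_int_of_pairs {f : ℤ → ℝ} (s : ℤ) {a b : ℝ}
    (he : HasSum (fun k : ℤ => f (s + 2 * k)) a) (ho : HasSum (fun k : ℤ => f (s + 2 * k + 1)) b) :
    HasSum f (a + b) := by
  have h1 : Function.Injective (fun k : ℤ => s + 2 * k) := fun k l h => by
    simp only at h; omega
  have h2 : Function.Injective (fun k : ℤ => s + 2 * k + 1) := fun k l h => by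
    simp only at h; omega
  refine HasSum.add_isCompl ?_ (h1.hasSum_range_iff.2 he) (h2.hasSum_range_iff.2 ho)
  refine IsCompl.of_eq ?_ ?_
  · ext n
    simp only [Set.inf_eq_inter, Set.mem_inter_iff, Set.mem_range, Set.bot_eq_empty,
      Set.mem_empty_iff_false, iff_false, not_and, not_exists]
    rintro ⟨k, hk⟩ l hl
    omega
  · ext n
    simp only [Set.sup_eq_union, Set.mem_union, Set.mem_range, Set.top_eq_univ, Set.mem_univ,
      iff_true]
    rcases Int.even_or_odd' (n - s) with ⟨k, hk | hk⟩
    · exact Or.inl ⟨k, by omega⟩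
    · exact Or.inr ⟨k, by omega⟩

/-- A block mixes its two sites, so norms compare only pair by pair, not site by site. -/
theorem summable_and_tsum_le_of_pairs {f g : ℤ → ℝ} (s : ℤ) {C : ℝ} (hf : ∀ n, 0 ≤ f n)
    (hg : Summable g)
    (h : ∀ n, Even (n - s) → f n + f (n + 1) ≤ C * (g n + g (n + 1))) :
    Summable f ∧ ∑' n, f n ≤ C * ∑' n, g n := by
  have h1 : Function.Injective (fun k : ℤ => s + 2 * k) := fun k l h => by
    simp only at h; omega
  have h2 : Function.Injective (fun k : ℤ => s + 2 * k + 1) := fun k l h => by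
    simp only at h; omega
  have hge := hg.comp_injective h1
  have hgo := hg.comp_injective h2
  have hk : ∀ k : ℤ, f (s + 2 * k) + f (s + 2 * k + 1)
      ≤ C * (g (s + 2 * k) + g (s + 2 * k + 1)) := fun k => h _ ⟨k, by ring⟩
  have hS : Summable fun k : ℤ => C * (g (s + 2 * k) + g (s + 2 * k + 1)) :=
    (hge.add hgo).mul_left C
  have hfe : Summable fun k : ℤ => f (s + 2 * k) :=
    hS.of_nonneg_of_le (fun k => hf _) fun k => by linarith [hk k, hf (s + 2 * k + 1)]
  have hfo : Summable fun k : ℤ => f (s + 2 * k + 1) :=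
    hS.of_nonneg_of_le (fun k => hf _) fun k => by linarith [hk k, hf (s + 2 * k)]
  have hF := hasSum_int_of_pairs s hfe.hasSum hfo.hasSum
  have hG := hasSum_int_of_pairs (f := g) s hge.hasSum hgo.hasSum
  refine ⟨hF.summable, ?_⟩
  rw [hF.tsum_eq, hG.tsum_eq, ← hfe.tsum_add hfo]
  have := (hfe.add hfo).tsum_le_tsum hk hS
  rw [tsum_mul_left] at this
  exact this.trans_eq (congrArg _ (hge.tsum_add hgo))

theorem EllTwo.summable_sq (ψ : EllTwo) : Summable fun n => ‖ψ n‖ ^ 2 := by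
  have h := (lp.hasSum_norm (p := 2) (by norm_num) ψ).summable
  simpa using h

theorem EllTwo.norm_sq_eq_tsum (ψ : EllTwo) : ‖ψ‖ ^ 2 = ∑' n, ‖ψ n‖ ^ 2 := by
  have h := lp.norm_rpow_eq_tsum (p := 2) (by norm_num) ψ
  simpa using h

theorem memℓp_two_of_summable_sq {f : ℤ → ℂ} (hf : Summable fun n => ‖f n‖ ^ 2) :
    Memℓp f 2 := by
  rw [memℓp_gen_iff (by norm_num)]
  simpa using hf

/-- The direct sum over `n ∈ s + 2ℤ` of the matrices `!![x n, y n; y n, -x n]` acting on the sites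
`n`, `n + 1`. -/
def blockApply (s : ℤ) (x y : ℤ → ℝ) (ψ : ℤ → ℂ) : ℤ → ℂ := fun n =>
  if Even (n - s) then x n * ψ n + y n * ψ (n + 1) else y (n - 1) * ψ (n - 1) - x (n - 1) * ψ n

theorem blockApply_of_even {s n : ℤ} (h : Even (n - s)) (x y : ℤ → ℝ) (ψ : ℤ → ℂ) :
    blockApply s x y ψ n = x n * ψ n + y n * ψ (n + 1) := if_pos h

theorem blockApply_of_not_even {s n : ℤ} (h : ¬ Even (n - s)) (x y : ℤ → ℝ) (ψ : ℤ → ℂ) :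
    blockApply s x y ψ n = y (n - 1) * ψ (n - 1) - x (n - 1) * ψ n := if_neg h

/-- The symmetric block squares to `x² + y²` times the identity, hence is a multiple of an isometry.
-/
theorem normSq_block (x y : ℝ) (u w : ℂ) :
    ‖x * u + y * w‖ ^ 2 + ‖y * u - x * w‖ ^ 2 = (x ^ 2 + y ^ 2) * (‖u‖ ^ 2 + ‖w‖ ^ 2) := by
  simp only [Complex.sq_norm, Complex.normSq_apply, Complex.add_re, Complex.add_im,
    Complex.sub_re, Complex.sub_im, Complex.re_ofReal_mul, Complex.im_ofReal_mul]
  ring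

theorem blockApply_summable_and_tsum_le (s : ℤ) {x y : ℤ → ℝ} {c : ℝ}
    (h : ∀ n, x n ^ 2 + y n ^ 2 ≤ c ^ 2) (ψ : EllTwo) :
    (Summable fun n => ‖blockApply s x y ψ n‖ ^ 2) ∧
      ∑' n, ‖blockApply s x y ψ n‖ ^ 2 ≤ c ^ 2 * ∑' n, ‖ψ n‖ ^ 2 := by
  refine summable_and_tsum_le_of_pairs s (fun n => by positivity) (EllTwo.summable_sq ψ) ?_
  intro n hn
  have hn' : ¬ Even (n + 1 - s) := by
    rw [show n + 1 - s = n - s + 1 by ring, Int.even_add_one, not_not]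
    exact hn
  rw [blockApply_of_even hn, blockApply_of_not_even hn', add_sub_cancel_right, normSq_block]
  exact mul_le_mul_of_nonneg_right (h n) (by positivity)

/-- `blockApply` as a bounded operator on `ℓ²(ℤ)`. -/
noncomputable def blockOp (s : ℤ) (x y : ℤ → ℝ) (c : ℝ) (h : ∀ n, x n ^ 2 + y n ^ 2 ≤ c ^ 2) :
    EllTwo →L[ℂ] EllTwo :=
  LinearMap.mkContinuous
    { toFun := fun ψ => ⟨blockApply s x y ψ,
        memℓp_two_of_summable_sq (blockApply_summable_and_tsum_le s h ψ).1⟩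
      map_add' := fun ψ φ => by
        ext n
        simp only [blockApply, lp.coeFn_add, Pi.add_apply]
        split_ifs <;> ring
      map_smul' := fun a ψ => by
        ext n
        simp only [blockApply, lp.coeFn_smul, Pi.smul_apply, smul_eq_mul, RingHom.id_apply]
        split_ifs <;> ring }
    |c| (fun ψ => by
      refine le_of_sq_le_sq ?_ (by positivity)
      rw [mul_pow, sq_abs, EllTwo.norm_sq_eq_tsum, EllTwo.norm_sq_eq_tsum]
      exact (blockApply_summable_and_tsum_le s h ψ).2)

theorem norm_blockOp_le (s : ℤ) (x y : ℤ → ℝ) (c : ℝ) (h : ∀ n, x n ^ 2 + y n ^ 2 ≤ c ^ 2) :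
    ‖blockOp s x y c h‖ ≤ |c| :=
  LinearMap.mkContinuous_norm_le _ (abs_nonneg c) _

theorem blockOp_mul_self (s : ℤ) (x y : ℤ → ℝ) (c : ℝ) (h : ∀ n, x n ^ 2 + y n ^ 2 ≤ c ^ 2)
    (h1 : ∀ n, x n ^ 2 + y n ^ 2 = 1) : blockOp s x y c h * blockOp s x y c h = 1 := by
  ext ψ n
  change blockApply s x y (blockApply s x y ψ) n = ψ n
  have hC : ∀ k, (x k : ℂ) ^ 2 + (y k : ℂ) ^ 2 = 1 := fun k => by exact_mod_cast h1 k
  by_cases hn : Even (n - s)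
  · have hn' : ¬ Even (n + 1 - s) := by
      rw [show n + 1 - s = n - s + 1 by ring, Int.even_add_one, not_not]
      exact hn
    rw [blockApply_of_even hn, blockApply_of_even hn, blockApply_of_not_even hn',
      add_sub_cancel_right]
    linear_combination (ψ n) * hC n
  · have hn' : Even (n - 1 - s) := by
      rw [show n - 1 - s = n - s - 1 by ring, Int.even_sub_one]
      exact hn
    rw [blockApply_of_not_even hn, blockApply_of_not_even hn, blockApply_of_even hn',
      sub_add_cancel]
    linear_combination (ψ n) * hC (n - 1)

/-- The sum of the two block operators on `2ℤ` and `2ℤ + 1` is tridiagonal. -/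
theorem blockApply_zero_add_blockApply_one (x y : ℤ → ℝ) (ψ : ℤ → ℂ) (n : ℤ) :
    blockApply 0 x y ψ n + blockApply 1 x y ψ n
      = y (n - 1) * ψ (n - 1) + (x n - x (n - 1)) * ψ n + y n * ψ (n + 1) := by
  by_cases hn : Even (n - 0)
  · have hn' : ¬ Even (n - 1) := by rw [Int.even_sub_one, not_not]; simpa using hn
    rw [blockApply_of_even hn, blockApply_of_not_even hn']
    ring
  · have hn' : Even (n - 1) := by rw [Int.even_sub_one]; simpa using hn
    rw [blockApply_of_not_even hn, blockApply_of_even hn']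
    ring

theorem rho_eq_of_real {α : Disk} {t : ℝ} (h : (α : ℂ) = t) : rho α = (√(1 - t ^ 2) : ℝ) := by
  rw [rho, h, Complex.norm_real, Real.norm_eq_abs, sq_abs]

/-- The `LM` factorization of an extended CMV matrix with real Verblunsky coefficients. -/
theorem extendedCMV_eq_blockOp_mul_blockOp {α : ℤ → Disk} {t : ℤ → ℝ}
    (hα : ∀ n, (α n : ℂ) = t n) (c : ℝ)
    (h : ∀ n, t n ^ 2 + √(1 - t n ^ 2) ^ 2 ≤ c ^ 2) :
    extendedCMV α = blockOp 0 t (fun n => √(1 - t n ^ 2)) c h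
      * blockOp 1 t (fun n => √(1 - t n ^ 2)) c h := by
  ext ψ n
  rw [extendedCMV_apply]
  change _ = blockApply 0 t (fun n => √(1 - t n ^ 2))
    (blockApply 1 t (fun n => √(1 - t n ^ 2)) ψ) n
  have hI : Finset.Icc (-2 : ℤ) 2 = {-2, -1, 0, 1, 2} := rfl
  have hr : ∀ n, rho (α n) = (√(1 - t n ^ 2) : ℝ) := fun n => rho_eq_of_real (hα n)
  have hs : ∀ r : ℝ, star (r : ℂ) = r := fun r => Complex.conj_ofReal r
  simp only [cmvApply, hI, cmvMatrix, hα, hr, hs]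
  by_cases hn : Even (n - 0)
  · have hn0 : Even n := by simpa using hn
    have h1 : ¬ Even (n - 1) := by rw [Int.even_sub_one, not_not]; exact hn0
    have h2 : Even (n + 1 - 1) := by simpa using hn0
    rw [blockApply_of_even hn, blockApply_of_not_even h1, blockApply_of_even h2]
    simp [hn0, sub_eq_add_neg]
    ring_nf
  · have hn0 : ¬ Even n := by simpa using hn
    have h1 : Even (n - 1) := by rw [Int.even_sub_one]; exact hn0
    have h2 : ¬ Even (n - 1 - 1) := by rw [Int.even_sub_one, not_not]; exact h1
    rw [blockApply_of_not_even hn, blockApply_of_not_even h2, blockApply_of_even h1]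
    simp [hn0, sub_eq_add_neg]
    ring_nf

/-! ### Random coefficients and the support -/

/-- Disjoint windows of length `N` give independent events of the same positive probability `ν U ^
N`; the second Borel–Cantelli lemma applies. -/
theorem ae_exists_stretch (ν : Measure Disk) [IsProbabilityMeasure ν] {U : Set Disk}
    (hU : MeasurableSet U) (hpos : ν U ≠ 0) (N : ℕ) :
    ∀ᵐ ω ∂(Measure.infinitePi (fun _ : ℤ => ν)),
      ∃ m : ℤ, ∀ j ∈ Set.Ico m (m + N), ω j ∈ U := by
  let P : Measure (ℤ → Disk) := Measure.infinitePi (fun _ : ℤ => ν)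
  let S : ℕ → Finset ℤ := fun i => Finset.Ico ((i : ℤ) * N) ((i : ℤ) * N + N)
  let B : ℕ → Set (ℤ → Disk) := fun i => Set.pi (S i : Set ℤ) (fun _ => U)
  have hdisj : ∀ i j, i ≠ j → Disjoint (S i) (S j) := by
    intro i j hij
    rw [Finset.disjoint_left]
    intro x hx hy
    simp only [S, Finset.mem_Ico] at hx hy
    rcases lt_or_gt_of_ne hij with h | h
    · have : ((i : ℤ) + 1) * N ≤ j * N := by gcongr; exact_mod_cast h
      linarith
    · have : ((j : ℤ) + 1) * N ≤ i * N := by gcongr; exact_mod_cast h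
      linarith
  have hBm : ∀ i, MeasurableSet (B i) := fun i =>
    MeasurableSet.pi (Finset.countable_toSet _) (fun _ _ => hU)
  have hBP : ∀ i, P (B i) = ν U ^ N := by
    intro i
    rw [Measure.infinitePi_pi _ (fun _ _ => hU)]
    simp [S]
  have hind : ProbabilityTheory.iIndepSet B P := by
    rw [ProbabilityTheory.iIndepSet_iff_meas_biInter hBm]
    intro s
    have h1 : (⋂ i ∈ s, B i) = Set.pi ((s.biUnion S : Finset ℤ) : Set ℤ) (fun _ => U) := by
      ext ω
      simp only [B, Set.mem_iInter, Set.mem_pi, Finset.mem_coe, Finset.mem_biUnion]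
      exact ⟨fun h x ⟨i, hi, hx⟩ => h i hi x hx, fun h i hi x hx => h x ⟨i, hi, hx⟩⟩
    rw [h1, Measure.infinitePi_pi _ (fun _ _ => hU),
      Finset.prod_biUnion (fun i _ j _ hij => hdisj i j hij)]
    refine Finset.prod_congr rfl (fun i _ => ?_)
    rw [Measure.infinitePi_pi _ (fun _ _ => hU)]
  have hlim := ProbabilityTheory.measure_limsup_eq_one hBm hind (by
    simp only [hBP]
    exact ENNReal.tsum_const_eq_top_of_ne_zero (pow_ne_zero _ hpos))
  have hae : ∀ᵐ ω ∂P, ω ∈ Filter.limsup B Filter.atTop :=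
    (prob_compl_eq_zero_iff (MeasurableSet.measurableSet_limsup hBm)).2 hlim
  filter_upwards [hae] with ω hω
  rw [Filter.mem_limsup_iff_frequently_mem] at hω
  obtain ⟨i, hi⟩ := hω.exists
  refine ⟨(i : ℤ) * N, fun j hj => hi j ?_⟩
  simpa [S] using hj

theorem ae_forall_mem_support (ν : Measure Disk) [IsProbabilityMeasure ν] :
    ∀ᵐ ω ∂(Measure.infinitePi (fun _ : ℤ => ν)), ∀ n, ω n ∈ ν.support := by
  rw [ae_all_iff]
  intro n
  have h : ∀ᵐ α ∂ν, α ∈ ν.support := Measure.support_mem_ae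
  exact (measurePreserving_eval_infinitePi (fun _ : ℤ => ν) n).quasiMeasurePreserving.ae h

/-- As `[0, 1)` is not compact, the search is cut off at a support point `t₀ < 1`; a minimum over
`[0, t₀]` is a global one. -/
theorem exists_isLeast_realSupport (ν : Measure Disk) [IsProbabilityMeasure ν]
    (hν : ∀ α ∈ ν.support, ∃ t ∈ Set.Icc (0 : ℝ) 1, (α : ℂ) = (t : ℂ)) :
    ∃ a : ℝ, IsLeast (realSupport ν) a := by
  obtain ⟨α₀, hα₀⟩ := Measure.nonempty_support (μ := ν) (IsProbabilityMeasure.ne_zero ν)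
  obtain ⟨t₀, ht₀, hα₀t⟩ := hν α₀ hα₀
  have ht₀1 : t₀ < 1 := by
    have := mem_ball_zero_iff.1 α₀.2
    rw [hα₀t, Complex.norm_real] at this
    exact (le_abs_self _).trans_lt this
  have hmem : ∀ t : Set.Icc (0 : ℝ) t₀, ((t : ℝ) : ℂ) ∈ Metric.ball (0 : ℂ) 1 := by
    rintro ⟨t, h0, h1⟩
    rw [mem_ball_zero_iff, Complex.norm_real, Real.norm_of_nonneg h0]
    exact h1.trans_lt ht₀1
  let f : Set.Icc (0 : ℝ) t₀ → Disk := fun t => ⟨((t : ℝ) : ℂ), hmem t⟩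
  have hf : Continuous f := by
    refine Continuous.subtype_mk ?_ _
    exact Complex.continuous_ofReal.comp continuous_subtype_val
  have hcl : IsClosed (f ⁻¹' ν.support) := Measure.isClosed_support.preimage hf
  obtain ⟨t, ht, hmin⟩ := hcl.isCompact.exists_isLeast
    ⟨⟨t₀, ht₀.1, le_rfl⟩, by
      change f _ ∈ ν.support
      convert hα₀
      exact Subtype.ext hα₀t.symm⟩
  refine ⟨t, ⟨f t, ht, rfl⟩, ?_⟩
  rintro s ⟨α, hα, hαs⟩
  obtain ⟨s', hs', hαs'⟩ := hν α hα
  have hss : s' = s := by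
    have := hαs'.symm.trans hαs
    exact_mod_cast this
  subst hss
  rcases le_total s' t₀ with h | h
  · have : (⟨s', hs'.1, h⟩ : Set.Icc (0 : ℝ) t₀) ∈ f ⁻¹' ν.support := by
      change f _ ∈ ν.support
      convert hα
      exact Subtype.ext hαs'.symm
    exact hmin this
  · exact t.2.2.trans h

/-! ### Geometry of the arc -/

/-- The points of the unit circle outside the gap, in Cartesian form. -/
theorem sphere_diff_gapArc_eq {a : ℝ} (h0 : 0 ≤ a) (h1 : a < 1) :
    Metric.sphere (0 : ℂ) 1 \ gapArc a = {z : ℂ | ‖z‖ = 1 ∧ z.re ≤ 1 - 2 * a ^ 2} := by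
  have hA0 : 0 ≤ Real.arcsin a := Real.arcsin_nonneg.2 h0
  have hA1 : Real.arcsin a < Real.pi / 2 := Real.arcsin_lt_pi_div_two.2 h1
  have hcos : Real.cos (2 * Real.arcsin a) = 1 - 2 * a ^ 2 := by
    rw [Real.cos_two_mul, Real.cos_sq', Real.sin_arcsin (by linarith) h1.le]
    ring
  have hexp : ∀ θ : ℝ, (Complex.exp (θ * Complex.I)).re = Real.cos θ :=
    Complex.exp_ofReal_mul_I_re
  ext z
  simp only [Set.mem_sdiff, mem_sphere_zero_iff_norm, Set.mem_ofPred_eq, and_congr_right_iff]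
  intro hz
  have hzarg : z = Complex.exp (z.arg * Complex.I) := by
    conv_lhs => rw [← Complex.norm_mul_exp_arg_mul_I z, hz]
    simp
  rw [← not_lt, not_iff_not, ← hcos]
  constructor
  · rintro ⟨θ, hl, hu, rfl⟩
    rw [hexp, ← Real.cos_abs θ]
    exact Real.cos_lt_cos_of_nonneg_of_le_pi (abs_nonneg _) (by linarith)
      (abs_lt.2 ⟨by linarith, hu⟩)
  · intro h
    refine ⟨z.arg, ?_⟩
    rw [← and_assoc]
    refine ⟨?_, hzarg⟩
    rw [← abs_lt]
    by_contra! hc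
    have := Real.cos_le_cos_of_nonneg_of_le_pi (by linarith) (Complex.abs_arg_le_pi z) hc
    rw [Real.cos_abs, ← hexp, ← hzarg] at this
    linarith

theorem setOf_exp_eq_sphere_diff_gapArc {a : ℝ} (h0 : 0 ≤ a) (h1 : a < 1) :
    {z : ℂ | ∃ θ ∈ Set.Ico (-Real.pi) Real.pi,
      2 * Real.arcsin a ≤ |θ| ∧ z = Complex.exp (θ * Complex.I)}
      = Metric.sphere (0 : ℂ) 1 \ gapArc a := by
  have hA0 : 0 ≤ Real.arcsin a := Real.arcsin_nonneg.2 h0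
  have hA1 : Real.arcsin a < Real.pi / 2 := Real.arcsin_lt_pi_div_two.2 h1
  have hcos : Real.cos (2 * Real.arcsin a) = 1 - 2 * a ^ 2 := by
    rw [Real.cos_two_mul, Real.cos_sq', Real.sin_arcsin (by linarith) h1.le]
    ring
  rw [sphere_diff_gapArc_eq h0 h1]
  ext z
  constructor
  · rintro ⟨θ, hθ, h, rfl⟩
    refine ⟨Complex.norm_exp_ofReal_mul_I θ, ?_⟩
    rw [Complex.exp_ofReal_mul_I_re, ← Real.cos_abs, ← hcos]
    exact Real.cos_le_cos_of_nonneg_of_le_pi (by linarith) (abs_le.2 ⟨hθ.1, hθ.2.le⟩) h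
  · rintro ⟨hz, hre⟩
    have hzarg : z = Complex.exp (z.arg * Complex.I) := by
      conv_lhs => rw [← Complex.norm_mul_exp_arg_mul_I z, hz]
      simp
    have habs : 2 * Real.arcsin a ≤ |z.arg| := by
      by_contra! hc
      have := Real.cos_lt_cos_of_nonneg_of_le_pi (abs_nonneg _) (by linarith) hc
      rw [Real.cos_abs, ← Complex.exp_ofReal_mul_I_re z.arg, ← hzarg] at this
      linarith
    rcases (Complex.arg_le_pi z).lt_or_eq with h | h
    · exact ⟨z.arg, ⟨(Complex.neg_pi_lt_arg z).le, h⟩, habs, hzarg⟩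
    -- `arg` takes values in `(-π, π]`, so the point `-1` must be given the angle `-π`.
    · refine ⟨-Real.pi, ⟨le_rfl, by linarith [Real.pi_pos]⟩, ?_, ?_⟩
      · rwa [abs_neg, ← h]
      · rw [hzarg, h]
        push_cast
        rw [neg_mul, Complex.exp_neg, Complex.exp_pi_mul_I]
        norm_num

theorem isClosed_sphere_diff_gapArc {a : ℝ} (h0 : 0 ≤ a) (h1 : a < 1) :
    IsClosed (Metric.sphere (0 : ℂ) 1 \ gapArc a) := by
  rw [sphere_diff_gapArc_eq h0 h1]
  exact (isClosed_eq continuous_norm continuous_const).inter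
    (isClosed_le Complex.continuous_re continuous_const)

/-! ### Approximate eigenvectors of the tridiagonal operator -/

theorem blockOp_add_blockOp_apply (x y : ℤ → ℝ) (c : ℝ) (h : ∀ n, x n ^ 2 + y n ^ 2 ≤ c ^ 2)
    (ψ : EllTwo) (n : ℤ) :
    ((blockOp 0 x y c h + blockOp 1 x y c h) ψ : EllTwo) n
      = y (n - 1) * ψ (n - 1) + (x n - x (n - 1)) * ψ n + y n * ψ (n + 1) :=
  blockApply_zero_add_blockApply_one x y ψ n

/-- Provides the `NormOneClass` structure on operators that the spectral bounds require. -/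
instance EllTwo.nontrivial : Nontrivial EllTwo :=
  ⟨⟨lp.single 2 0 1, 0, fun h => by
    have := congrArg (fun ψ : EllTwo => ψ 0) h
    simp at this⟩⟩

/-- A truncated plane wave is an approximate eigenvector of a tridiagonal operator on a stretch
where the coefficients are almost constant. -/
theorem exists_truncated_plane_wave {J : EllTwo →L[ℂ] EllTwo} {x y : ℤ → ℝ}
    (hJ : ∀ (ψ : EllTwo) n, (J ψ : EllTwo) n
      = y (n - 1) * ψ (n - 1) + (x n - x (n - 1)) * ψ n + y n * ψ (n + 1))
    (hx : ∀ n, |x n| ≤ 1) (hy : ∀ n, |y n| ≤ 1) {a r κ η : ℝ} (hr : |r| ≤ 1)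
    {m : ℤ} {N : ℕ}
    (hxm : ∀ j ∈ Set.Ico m (m + N), |x j - a| ≤ η) (hym : ∀ j ∈ Set.Ico m (m + N), |y j - r| ≤ η) :
    ∃ v : EllTwo, ‖v‖ ^ 2 = N ∧
      ‖J v - ((2 * r * Real.cos κ : ℝ) : ℂ) • v‖ ^ 2 ≤ 16 * η ^ 2 * N + 144 := by
  let e : ℤ → ℂ := fun n => Complex.exp ((κ * n : ℝ) * Complex.I)
  have he : ∀ n, ‖e n‖ = 1 := fun n => Complex.norm_exp_ofReal_mul_I _
  have hrec : ∀ n, e (n - 1) + e (n + 1) = 2 * Real.cos κ * e n := by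
    intro n
    have h1 : e (n - 1) = e n * Complex.exp (-(κ * Complex.I)) := by
      simp only [e]; rw [← Complex.exp_add]; congr 1; push_cast; ring
    have h2 : e (n + 1) = e n * Complex.exp (κ * Complex.I) := by
      simp only [e]; rw [← Complex.exp_add]; congr 1; push_cast; ring
    rw [h1, h2, Complex.ofReal_cos, Complex.two_cos, neg_mul]
    ring
  let I : Finset ℤ := Finset.Ico m (m + N)
  let f : ℤ → ℂ := fun n => if n ∈ I then e n else 0
  have hfI : ∀ n ∈ I, f n = e n := fun n hn => if_pos hn
  have hfI' : ∀ n ∉ I, f n = 0 := fun n hn => if_neg hn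
  have hf1 : ∀ n, ‖f n‖ ≤ 1 := by
    intro n
    by_cases hn : n ∈ I
    · rw [hfI n hn, he]
    · rw [hfI' n hn, norm_zero]; exact zero_le_one
  have hfs : ∀ n ∉ I, ‖f n‖ ^ 2 = 0 := fun n hn => by rw [hfI' n hn]; simp
  let v : EllTwo := ⟨f, memℓp_two_of_summable_sq (summable_of_ne_finset_zero hfs)⟩
  have hv : ∀ n, v n = f n := fun n => rfl
  refine ⟨v, ?_, ?_⟩
  · rw [EllTwo.norm_sq_eq_tsum, tsum_eq_sum (s := I) hfs,
      Finset.sum_congr rfl (g := fun _ => (1 : ℝ)) (fun n hn => by rw [hfI n hn, he, one_pow])]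
    simp [I]
  set w : EllTwo := J v - ((2 * r * Real.cos κ : ℝ) : ℂ) • v with hw
  have hwn : ∀ n, w n = y (n - 1) * f (n - 1) + (x n - x (n - 1)) * f n + y n * f (n + 1)
      - ((2 * r * Real.cos κ : ℝ) : ℂ) * f n := by
    intro n
    rw [hw, lp.coeFn_sub, Pi.sub_apply, hJ]
    rfl
  let T : Finset ℤ := Finset.Ico (m - 1) (m + N + 1)
  -- The sites where the truncation is felt; at the other sites of `T` both neighbours lie in `I`.
  let E : Finset ℤ := {m - 1, m, m + N - 1, m + N}
  have hzero : ∀ n ∉ T, ‖w n‖ ^ 2 = 0 := by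
    intro n hn
    have hn' : ¬ (m - 1 ≤ n ∧ n < m + N + 1) := by simpa [T] using hn
    rw [hwn, hfI' n (by simp only [I, Finset.mem_Ico]; omega),
      hfI' (n - 1) (by simp only [I, Finset.mem_Ico]; omega),
      hfI' (n + 1) (by simp only [I, Finset.mem_Ico]; omega)]
    simp
  -- `6 = 1 + 2 + 1 + 2`, one summand per term of `w n`; the four edge sites then give `144 = 4 *
  -- 6²`.
  have hcrude : ∀ n, ‖w n‖ ≤ 6 := by
    intro n
    have hc1 : ∀ (u : ℝ) (k : ℤ) (C : ℝ), |u| ≤ C → ‖(u : ℂ) * f k‖ ≤ C := by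
      intro u k C hu
      rw [norm_mul, Complex.norm_real, Real.norm_eq_abs]
      exact (mul_le_of_le_one_right (abs_nonneg _) (hf1 k)).trans hu
    have h1 := hc1 (y (n - 1)) (n - 1) 1 (hy _)
    have h2 := hc1 (x n - x (n - 1)) n 2 (by
      have := abs_sub (x n) (x (n - 1)); linarith [hx n, hx (n - 1)])
    have h3 := hc1 (y n) (n + 1) 1 (hy _)
    have h4 := hc1 (2 * r * Real.cos κ) n 2 (by
      rw [abs_mul, abs_mul, abs_two]
      have := mul_le_one₀ hr (abs_nonneg _) (Real.abs_cos_le_one κ)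
      linarith)
    rw [hwn]
    push_cast at h2 h4 ⊢
    refine (norm_sub_le _ _).trans ?_
    have := norm_add₃_le (a := (y (n - 1) : ℂ) * f (n - 1))
      (b := ((x n : ℂ) - x (n - 1)) * f n) (c := (y n : ℂ) * f (n + 1))
    linarith
  have hfine : ∀ n ∈ T, n ∉ E → n ∈ I ∧ ‖w n‖ ≤ 4 * η := by
    intro n hnT hnE
    simp only [T, Finset.mem_Ico] at hnT
    simp only [E, Finset.mem_insert, Finset.mem_singleton, not_or] at hnE
    obtain ⟨e1, e2, e3, e4⟩ := hnE
    have i0 : n ∈ I := by simp only [I, Finset.mem_Ico]; omega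
    have i1 : n - 1 ∈ I := by simp only [I, Finset.mem_Ico]; omega
    have i2 : n + 1 ∈ I := by simp only [I, Finset.mem_Ico]; omega
    refine ⟨i0, ?_⟩
    have j0 : n ∈ Set.Ico m (m + N) := by simpa [I] using i0
    have j1 : n - 1 ∈ Set.Ico m (m + N) := by simpa [I] using i1
    -- The plane wave solves the constant-coefficient equation exactly and `a` cancels in the
    -- diagonal, leaving four errors of size `η`.
    have hid : w n = ((y (n - 1) - r : ℝ) : ℂ) * e (n - 1) + ((x n - a : ℝ) : ℂ) * e n
        - ((x (n - 1) - a : ℝ) : ℂ) * e n + ((y n - r : ℝ) : ℂ) * e (n + 1) := by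
      rw [hwn, hfI _ i0, hfI _ i1, hfI _ i2]
      simp only [Complex.ofReal_sub, Complex.ofReal_mul, Complex.ofReal_ofNat]
      linear_combination (r : ℂ) * hrec n
    have hc1 : ∀ (u : ℝ) (k : ℤ), |u| ≤ η → ‖(u : ℂ) * e k‖ ≤ η := by
      intro u k hu
      rwa [norm_mul, he, mul_one, Complex.norm_real, Real.norm_eq_abs]
    rw [hid]
    have h1 := hc1 _ (n - 1) (hym _ j1)
    have h2 := hc1 _ n (hxm _ j0)
    have h3 := hc1 _ n (hxm _ j1)
    have h4 := hc1 _ (n + 1) (hym _ j0)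
    refine (norm_add_le _ _).trans ?_
    refine (add_le_add_left (norm_sub_le _ _) _).trans ?_
    refine (add_le_add_left (add_le_add_left (norm_add_le _ _) _) _).trans ?_
    linarith
  have hbound : ∀ n ∈ T, ‖w n‖ ^ 2
      ≤ (if n ∈ I then 16 * η ^ 2 else 0) + (if n ∈ E then 36 else 0) := by
    intro n hn
    by_cases hE : n ∈ E
    · rw [if_pos hE]
      have h1 : ‖w n‖ ^ 2 ≤ 6 ^ 2 := by gcongr; exact hcrude n
      have h2 : (0 : ℝ) ≤ if n ∈ I then 16 * η ^ 2 else 0 := by split_ifs <;> positivity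
      linarith
    · obtain ⟨hI, hle⟩ := hfine n hn hE
      rw [if_neg hE, if_pos hI]
      have : ‖w n‖ ^ 2 ≤ (4 * η) ^ 2 := by gcongr
      linarith
  rw [EllTwo.norm_sq_eq_tsum, tsum_eq_sum (s := T) hzero]
  refine (Finset.sum_le_sum hbound).trans ?_
  rw [Finset.sum_add_distrib, Finset.sum_ite_mem, Finset.sum_ite_mem, Finset.sum_const,
    Finset.sum_const, nsmul_eq_mul, nsmul_eq_mul]
  have hcI : ((T ∩ I).card : ℝ) ≤ N := by
    have := Finset.card_le_card (Finset.inter_subset_right (s₁ := T) (s₂ := I))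
    have hI : I.card = N := by simp [I]
    exact_mod_cast this.trans_eq hI
  have hcE : ((T ∩ E).card : ℝ) ≤ 4 := by
    have := Finset.card_le_card (Finset.inter_subset_right (s₁ := T) (s₂ := E))
    exact_mod_cast this.trans Finset.card_le_four
  nlinarith [mul_le_mul_of_nonneg_right hcI (by positivity : 0 ≤ 16 * η ^ 2)]

/-- If the coefficients come arbitrarily close to constants on arbitrarily long stretches, then the
tridiagonal operator minus a point of the band of the limiting operator is not left invertible. -/
theorem not_exists_left_inverse_of_stretches {J : EllTwo →L[ℂ] EllTwo} {x y : ℤ → ℝ}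
    (hJ : ∀ (ψ : EllTwo) n, (J ψ : EllTwo) n
      = y (n - 1) * ψ (n - 1) + (x n - x (n - 1)) * ψ n + y n * ψ (n + 1))
    (hx : ∀ n, |x n| ≤ 1) (hy : ∀ n, |y n| ≤ 1) {a r κ : ℝ} (hr : |r| ≤ 1)
    (hstretch : ∀ k N : ℕ, ∃ m : ℤ, ∀ j ∈ Set.Ico m (m + N),
      |x j - a| ≤ 1 / (k + 1) ∧ |y j - r| ≤ 1 / (k + 1)) :
    ¬ ∃ X : EllTwo →L[ℂ] EllTwo,
      X * (J - algebraMap ℂ _ ((2 * r * Real.cos κ : ℝ) : ℂ)) = 1 := by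
  rintro ⟨X, hX⟩
  -- Chosen so that in `hsq` the bulk error is at most `N / 2` and the edge error is strictly below
  -- `N / 2`.
  obtain ⟨k, hk⟩ := exists_nat_gt (32 * ‖X‖ ^ 2)
  obtain ⟨N, hN⟩ := exists_nat_gt (288 * ‖X‖ ^ 2)
  obtain ⟨m, hm⟩ := hstretch k N
  obtain ⟨v, hv, hRv⟩ := exists_truncated_plane_wave (κ := κ) hJ hx hy hr
    (fun j hj => (hm j hj).1) (fun j hj => (hm j hj).2)
  have hXv : v = X (J v - ((2 * r * Real.cos κ : ℝ) : ℂ) • v) := by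
    have := congrArg (fun T : EllTwo →L[ℂ] EllTwo => T v) hX
    simpa [Algebra.algebraMap_eq_smul_one] using this.symm
  have hle : ‖v‖ ≤ ‖X‖ * ‖J v - ((2 * r * Real.cos κ : ℝ) : ℂ) • v‖ := by
    conv_lhs => rw [hXv]
    exact X.le_opNorm _
  have hsq : (N : ℝ) ≤ ‖X‖ ^ 2 * (16 * (1 / ((k : ℝ) + 1)) ^ 2 * N + 144) := by
    rw [← hv]
    calc ‖v‖ ^ 2 ≤ (‖X‖ * ‖J v - ((2 * r * Real.cos κ : ℝ) : ℂ) • v‖) ^ 2 := by gcongr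
      _ = ‖X‖ ^ 2 * ‖J v - ((2 * r * Real.cos κ : ℝ) : ℂ) • v‖ ^ 2 := mul_pow _ _ _
      _ ≤ _ := by
        rw [hv]
        gcongr
  have hk1 : (1 / ((k : ℝ) + 1)) ^ 2 * (32 * ‖X‖ ^ 2) ≤ 1 := by
    rw [one_div, inv_pow, inv_mul_le_iff₀ (by positivity)]
    nlinarith [Nat.cast_nonneg (α := ℝ) k]
  have hN0 : (0 : ℝ) ≤ N := Nat.cast_nonneg N
  nlinarith [mul_le_mul_of_nonneg_right hk1 hN0]

/-! ### The two inclusions for deterministic coefficients -/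

section RealCoefficients

variable {α : ℤ → Disk} {t : ℤ → ℝ} {a : ℝ}

/-- The spectrum of an extended CMV matrix with coefficients in `[a, 1)` avoids the gap. -/
theorem spectrum_extendedCMV_subset (hα : ∀ n, (α n : ℂ) = t n) (h0 : 0 ≤ a)
    (ha : ∀ n, a ≤ t n) (ht : ∀ n, t n ≤ 1) :
    spectrum ℂ (extendedCMV α) ⊆ {z : ℂ | ‖z‖ = 1 ∧ z.re ≤ 1 - 2 * a ^ 2} := by
  set y : ℤ → ℝ := fun n => √(1 - t n ^ 2) with hy
  have hsq : ∀ n, y n ^ 2 = 1 - t n ^ 2 := fun n =>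
    Real.sq_sqrt (by nlinarith [ha n, ht n])
  have h1 : ∀ n, t n ^ 2 + y n ^ 2 = 1 := fun n => by rw [hsq]; ring
  have h : ∀ n, t n ^ 2 + y n ^ 2 ≤ 1 ^ 2 := fun n => by rw [h1]; norm_num
  -- The left side is `1 - 2 a t + a²`, and `a t ≥ a²`.
  have h' : ∀ n, (t n - a) ^ 2 + y n ^ 2 ≤ √(1 - a ^ 2) ^ 2 := fun n => by
    rw [hsq, Real.sq_sqrt (by nlinarith [ha 0, ht 0])]
    nlinarith [ha n]
  intro z hz
  rw [extendedCMV_eq_blockOp_mul_blockOp hα 1 h] at hz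
  have hL := blockOp_mul_self 0 t y 1 h h1
  have hM := blockOp_mul_self 1 t y 1 h h1
  have hLn := norm_blockOp_le 0 t y 1 h
  have hMn := norm_blockOp_le 1 t y 1 h
  rw [abs_one] at hLn hMn
  have hz1 := norm_eq_one_of_mem_spectrum_mul_involutions hL hM hLn hMn hz
  refine ⟨hz1, ?_⟩
  have hre := two_add_two_mul_re_le_of_mem_spectrum hL hM hz1 hz
  -- Shifting `t` by a constant leaves the diagonal `t n - t (n - 1)` unchanged but shrinks the norm
  -- of each summand.
  have hsum : blockOp 0 t y 1 h + blockOp 1 t y 1 h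
      = blockOp 0 (fun n => t n - a) y _ h' + blockOp 1 (fun n => t n - a) y _ h' := by
    ext ψ n
    rw [blockOp_add_blockOp_apply, blockOp_add_blockOp_apply]
    push_cast
    ring
  have hn : ‖blockOp 0 t y 1 h + blockOp 1 t y 1 h‖ ≤ 2 * √(1 - a ^ 2) := by
    rw [hsum]
    refine (norm_add_le _ _).trans ?_
    have e0 := norm_blockOp_le 0 (fun n => t n - a) y _ h'
    have e1 := norm_blockOp_le 1 (fun n => t n - a) y _ h'
    rw [abs_of_nonneg (Real.sqrt_nonneg _)] at e0 e1
    linarith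
  have hn2 : ‖blockOp 0 t y 1 h + blockOp 1 t y 1 h‖ ^ 2 ≤ 4 * (1 - a ^ 2) := by
    calc _ ≤ (2 * √(1 - a ^ 2)) ^ 2 := by gcongr
      _ = 4 * (1 - a ^ 2) := by
        rw [mul_pow, Real.sq_sqrt (by nlinarith [ha 0, ht 0])]; norm_num
  linarith

/-- With `μ = e^{i arg z / 2}`, the point `μ + μ⁻¹ = 2 cos (arg z / 2)` lies in the band `[-2r,
2r]`, where `J` minus that point has no left inverse. The value `z = 1` is left out because `1 - μ²`
vanishes there. -/
theorem mem_spectrum_extendedCMV_of_ne_one (hα : ∀ n, (α n : ℂ) = t n) (ht : ∀ n, |t n| ≤ 1)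
    (h0 : 0 ≤ a) (h1 : a < 1)
    (hstretch : ∀ k N : ℕ, ∃ m : ℤ, ∀ j ∈ Set.Ico m (m + N),
      |t j - a| ≤ 1 / (k + 1) ∧ |√(1 - t j ^ 2) - √(1 - a ^ 2)| ≤ 1 / (k + 1))
    {z : ℂ} (hz : ‖z‖ = 1) (hre : z.re ≤ 1 - 2 * a ^ 2) (hz1 : z ≠ 1) :
    z ∈ spectrum ℂ (extendedCMV α) := by
  set y : ℤ → ℝ := fun n => √(1 - t n ^ 2) with hy
  have hsq : ∀ n, y n ^ 2 = 1 - t n ^ 2 := fun n =>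
    Real.sq_sqrt (by have := (sq_le_one_iff_abs_le_one _).2 (ht n); linarith)
  have hty : ∀ n, t n ^ 2 + y n ^ 2 = 1 := fun n => by rw [hsq]; ring
  have h : ∀ n, t n ^ 2 + y n ^ 2 ≤ 1 ^ 2 := fun n => by rw [hty]; norm_num
  have hy1 : ∀ n, |y n| ≤ 1 := fun n =>
    (sq_le_one_iff_abs_le_one _).1 (by rw [hsq]; nlinarith [sq_nonneg (t n)])
  set r := √(1 - a ^ 2) with hr
  have hr2 : r ^ 2 = 1 - a ^ 2 := Real.sq_sqrt (by nlinarith)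
  have hr0 : 0 < r := Real.sqrt_pos.2 (by nlinarith)
  have hr1 : |r| ≤ 1 := (sq_le_one_iff_abs_le_one _).1 (by rw [hr2]; nlinarith)
  have hzarg : z = Complex.exp (z.arg * Complex.I) := by
    conv_lhs => rw [← Complex.norm_mul_exp_arg_mul_I z, hz]
    simp
  set μ : ℂ := Complex.exp ((z.arg / 2 : ℝ) * Complex.I) with hμ
  have hμz : μ ^ 2 = z := by
    conv_rhs => rw [hzarg]
    rw [hμ, ← Complex.exp_nat_mul]
    congr 1
    push_cast
    ring
  have hc2 : Real.cos (z.arg / 2) ^ 2 ≤ r ^ 2 := by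
    have e1 : z.re = 2 * Real.cos (z.arg / 2) ^ 2 - 1 := by
      rw [← Real.cos_two_mul, mul_div_cancel₀ _ two_ne_zero]
      conv_lhs => rw [hzarg]
      exact Complex.exp_ofReal_mul_I_re _
    rw [hr2]
    linarith
  have hcr := abs_le_of_sq_le_sq' hc2 hr0.le
  have hκ : r * Real.cos (Real.arccos (Real.cos (z.arg / 2) / r)) = Real.cos (z.arg / 2) := by
    rw [Real.cos_arccos (by rw [le_div_iff₀ hr0]; linarith) (by rw [div_le_one hr0]; exact hcr.2)]
    field_simp
  have hμs : μ + μ⁻¹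
      = ((2 * r * Real.cos (Real.arccos (Real.cos (z.arg / 2) / r)) : ℝ) : ℂ) := by
    rw [mul_assoc, hκ, hμ, ← Complex.exp_neg, Complex.ofReal_mul, Complex.ofReal_cos,
      Complex.ofReal_ofNat, Complex.two_cos, neg_mul]
  by_contra hspec
  rw [extendedCMV_eq_blockOp_mul_blockOp hα 1 h, ← hμz] at hspec
  have hX := exists_left_inverse_add_sub (blockOp_mul_self 0 t y 1 h hty)
    (blockOp_mul_self 1 t y 1 h hty) (Complex.exp_ne_zero _) (by rwa [hμz]) hspec
  rw [hμs] at hX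
  exact not_exists_left_inverse_of_stretches (blockOp_add_blockOp_apply t y 1 h) ht hy1 hr1
    hstretch hX

/-- The missing point `z = 1` is relevant only if `a = 0`; it is then the limit of `e^{is}` as `s ↓
0`, and the spectrum is closed. -/
theorem subset_spectrum_extendedCMV (hα : ∀ n, (α n : ℂ) = t n) (ht : ∀ n, |t n| ≤ 1)
    (h0 : 0 ≤ a) (h1 : a < 1)
    (hstretch : ∀ k N : ℕ, ∃ m : ℤ, ∀ j ∈ Set.Ico m (m + N),
      |t j - a| ≤ 1 / (k + 1) ∧ |√(1 - t j ^ 2) - √(1 - a ^ 2)| ≤ 1 / (k + 1)) :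
    {z : ℂ | ‖z‖ = 1 ∧ z.re ≤ 1 - 2 * a ^ 2} ⊆ spectrum ℂ (extendedCMV α) := by
  rintro z ⟨hz, hre⟩
  have key := fun z hz hre hz1 =>
    mem_spectrum_extendedCMV_of_ne_one hα ht h0 h1 hstretch (z := z) hz hre hz1
  by_cases hz1 : z = 1
  · subst hz1
    have ha : a = 0 := by
      rw [Complex.one_re] at hre
      nlinarith
    have hT : Filter.Tendsto (fun s : ℝ => Complex.exp (s * Complex.I))
        (nhdsWithin 0 (Set.Ioi 0)) (nhds 1) := by
      have : Continuous fun s : ℝ => Complex.exp (s * Complex.I) := by fun_prop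
      have h := this.tendsto 0
      simp only [Complex.ofReal_zero, zero_mul, Complex.exp_zero] at h
      exact h.mono_left nhdsWithin_le_nhds
    refine (spectrum.isClosed (𝕜 := ℂ) (extendedCMV α)).mem_of_tendsto hT ?_
    filter_upwards [Ioo_mem_nhdsGT Real.pi_pos] with s hs
    refine key _ (Complex.norm_exp_ofReal_mul_I s) ?_ ?_
    · rw [Complex.exp_ofReal_mul_I_re, ha]
      linarith [Real.cos_le_one s]
    · intro h
      have := congrArg Complex.im h
      rw [Complex.exp_ofReal_mul_I_im, Complex.one_im] at this
      exact (Real.sin_pos_of_pos_of_lt_pi hs.1 hs.2).ne' this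
  · exact key z hz hre hz1

end RealCoefficients

/-! ### The almost sure spectrum -/

theorem ae_spectrum_extendedCMV (ν : Measure Disk) [IsProbabilityMeasure ν]
    (hν : ∀ α ∈ ν.support, ∃ t ∈ Set.Icc (0 : ℝ) 1, (α : ℂ) = (t : ℂ)) {a : ℝ}
    (ha : IsLeast (realSupport ν) a) (h0 : 0 ≤ a) (h1 : a < 1) :
    ∀ᵐ ω ∂(Measure.infinitePi (fun _ : ℤ => ν)),
      spectrum ℂ (extendedCMV ω) = Metric.sphere (0 : ℂ) 1 \ gapArc a := by
  obtain ⟨α₀, hα₀, hα₀a⟩ := ha.1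
  -- Closeness of `ρ` is built into the neighbourhood, so its openness replaces any quantitative
  -- estimate of the square root.
  let U : ℕ → Set Disk := fun k => {α | |(α : ℂ).re - a| < 1 / (k + 1) ∧
    |√(1 - (α : ℂ).re ^ 2) - √(1 - a ^ 2)| < 1 / (k + 1)}
  have hUo : ∀ k, IsOpen (U k) := fun k => by
    have hc1 : Continuous fun α : Disk => |(α : ℂ).re - a| := by fun_prop
    have hc2 : Continuous fun α : Disk => |√(1 - (α : ℂ).re ^ 2) - √(1 - a ^ 2)| := by fun_prop
    exact (isOpen_lt hc1 continuous_const).inter (isOpen_lt hc2 continuous_const)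
  have hU : ∀ k, ν (U k) ≠ 0 := fun k => by
    refine ((Measure.mem_support_iff_forall _).1 hα₀ _ ((hUo k).mem_nhds ?_)).ne'
    have : (0 : ℝ) < 1 / (k + 1) := by positivity
    simpa [U, hα₀a] using this
  have hst : ∀ᵐ ω ∂(Measure.infinitePi (fun _ : ℤ => ν)), ∀ k N : ℕ,
      ∃ m : ℤ, ∀ j ∈ Set.Ico m (m + N), ω j ∈ U k :=
    ae_all_iff.2 fun k => ae_all_iff.2 fun N =>
      ae_exists_stretch ν (hUo k).measurableSet (hU k) N
  filter_upwards [hst, ae_forall_mem_support ν] with ω hω hs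
  have hreal : ∀ n, (ω n : ℂ) = ((ω n : ℂ).re : ℝ) := fun n => by
    obtain ⟨t, -, ht⟩ := hν _ (hs n)
    rw [ht, Complex.ofReal_re]
  have hle : ∀ n, |(ω n : ℂ).re| ≤ 1 := fun n =>
    (Complex.abs_re_le_norm _).trans (norm_disk_le _)
  rw [sphere_diff_gapArc_eq h0 h1]
  refine Set.Subset.antisymm
    (spectrum_extendedCMV_subset hreal h0 (fun n => ha.2 ⟨ω n, hs n, hreal n⟩)
      fun n => (abs_le.1 (hle n)).2)
    (subset_spectrum_extendedCMV hreal hle h0 h1 fun k N => ?_)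
  obtain ⟨m, hm⟩ := hω k N
  exact ⟨m, fun j hj => ⟨(hm j hj).1.le, (hm j hj).2.le⟩⟩

theorem theorem1p1 (ν : Measure Disk) [IsProbabilityMeasure ν]
    (hν : ∀ α ∈ ν.support, ∃ t ∈ Set.Icc (0 : ℝ) 1, (α : ℂ) = (t : ℂ)) :
    ∃ a : ℝ, IsLeast (realSupport ν) a ∧
      IsAlmostSureSpectrum ν
        {z : ℂ | ∃ θ ∈ Set.Ico (-Real.pi) Real.pi,
          2 * Real.arcsin a ≤ |θ| ∧ z = Complex.exp (θ * Complex.I)} ∧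
      IsAlmostSureSpectrum ν (Metric.sphere (0 : ℂ) 1 \ gapArc a) := by
  obtain ⟨a, ha⟩ := exists_isLeast_realSupport ν hν
  obtain ⟨α₀, hα₀, hα₀a⟩ := ha.1
  have h1 : a < 1 := by
    have := mem_ball_zero_iff.1 α₀.2
    rw [hα₀a, Complex.norm_real] at this
    exact (le_abs_self _).trans_lt this
  have h0 : 0 ≤ a := by
    obtain ⟨s, hs, hαs⟩ := hν _ hα₀
    have : s = a := by exact_mod_cast hαs.symm.trans hα₀a
    exact this ▸ hs.1
  refine ⟨a, ha, ?_⟩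
  rw [setOf_exp_eq_sphere_diff_gapArc h0 h1, and_self]
  exact ⟨isClosed_sphere_diff_gapArc h0 h1, Set.sdiff_subset,
    ae_spectrum_extendedCMV ν hν ha h0 h1⟩
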